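/- Corollary (edit perturbations). Let $p_S,p_I,q_I,p_D\in(0,1)$ and let $v=(v_S,v_I,v_D)\in[0,1]^3$ with $v_S+v_I+v_D=1$. Let $Y$ be the random mapping from infinite binary strings to finite or infinite binary strings that is computed by the following probabilistic finite automaton. It has a single input state $s$, in which it starts with probability $1$, and six output states $S_a,I_a,D_a$ ($a\in\{0,1\}$). In state $s$, on reading the next input symbol $a$, it moves to $S_a$ with probability $v_S$, to $I_a$ with probability $v_I$, to $D_a$ with probability $v_D(1-p_D)$, and stays in $s$ (so that $a$ is deleted) with probability $v_Dp_D$. In state $S_a$ it writes $1-a$ with probability $p_S$ and $a$ with probability $1-p_S$, and in either case returns to $s$. In state $I_a$ it writes $0$ and stays with probability $(1-p_I)q_I$, writes $1$ and stays with probability $(1-p_I)(1-q_I)$, and writes $a$ and returns to $s$ with probability $p_I$. In state $D_a$ it writes $a$ and returns to $s$ with probability $1$. All random choices are independent, and the output $Y(t)$ is the concatenation of all symbols written in the never-ending computation on the infinite input $t$. Thus $Y$ is the convex combination, with weights $v$, of the binary substitution, insertion and deletion perturbations. For $n\in\mathbb{N}$ let $$H(\{0,1\}^\omega,n,Y)=\sup_{A\subseteq\{0,1\}^\omega,\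 |A|=n}\ \mathbb{E}\Bigl[\max_{s,t\in A,\ s\ne t}\mathrm{lcp}\bigl(Y(s),Y(t)\bigr)\Bigr]\in[0,\infty]$$ be the smoothed trie height, where $\mathrm{lcp}$ denotes the length of the longest common prefix, the members of $A$ are perturbed independently of each other, and the maximum over an empty set of pairs is $0$. Then $H(\{0,1\}^\omega,n,Y)\in O(\log n)$ (that is, there are $C\in\mathbb{R}$ and $n_0\in\mathbb{N}$ with $H(\{0,1\}^\omega,n,Y)\le C\log n$ for all $n\ge n_0$) if and only if $v_D<1$. In other words, the smoothed trie height is logarithmic if and only if the convex combination of edit perturbations does not collapse to deletions. -/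

import Mathlib

open MeasureTheory ProbabilityTheory Filter
open scoped ENNReal

noncomputable section

namespace SmoothedTrie

/-- Finite and infinite strings over `α`, with positions counted from `0`. -/
abbrev Str (α : Type) : Type := Stream'.Seq α

/-- The σ-algebra on finite and infinite strings generated by the individual positions. -/
instance instMeasurableSpaceStr (α : Type) : MeasurableSpace (Stream'.Seq α) :=
  ⨆ k : ℕ, MeasurableSpace.comap (fun s : Stream'.Seq α => s.get? k) ⊤

/-- The length of the longest common prefix of two finite or infinite strings. -/
def lcp {α : Type} (x y : Str α) : ℕ∞ :=
  ⨆ (m : ℕ) (_ : ∀ k < m, ∃ a, x.get? k = some a ∧ y.get? k = some a), (m : ℕ∞)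

/-- A perturbation function: it maps an infinite string to a random finite or infinite string,
given by its law. -/
abbrev Perturbation (α : Type) : Type := (ℕ → α) → ProbabilityMeasure (Str α)

/-- The height of the trie over an indexed family of strings: the largest length of a common
prefix of two members with distinct indices (`0` if there are no two such members). -/
def trieHeight {α ι : Type} (x : ι → Str α) : ℕ∞ :=
  ⨆ (i : ι) (j : ι) (_ : i ≠ j), lcp (x i) (x j)

/-- The smoothed trie height `H(S, n, X)`: the supremum over all sets `A ⊆ S` of `n` distinct
infinite strings of the expected height of the trie over the strings `X(s)`, `s ∈ A`, where the
members of `A` are perturbed independently. -/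
def smoothedTrieHeight {α : Type} (S : Set (ℕ → α)) (n : ℕ) (X : Perturbation α) : ℝ≥0∞ :=
  ⨆ (A : Finset (ℕ → α)) (_ : (A : Set (ℕ → α)) ⊆ S ∧ A.card = n),
    ∫⁻ x : A → Str α, (trieHeight x : ℝ≥0∞)
      ∂(Measure.pi fun s : A => (X s.1 : Measure (Str α)))

/-- A Mealy-type probabilistic finite automaton over the alphabet `α` with input states `R` and
output states `W`. -/
structure PFA (α R W : Type) [Fintype α] [Fintype R] [Nonempty R] [Fintype W] [Nonempty W] where
  /-- `muR q a p`: probability of moving to `p` when the symbol `a` is read in the input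
  state `q`. -/
  muR : R → α → R ⊕ W → ℝ
  muR_nonneg : ∀ q a p, 0 ≤ muR q a p
  muR_sum : ∀ q a, ∑ p, muR q a p = 1
  /-- `muW q a p`: probability of writing the symbol `a` and moving to `p` in the output
  state `q`. -/
  muW : W → α → R ⊕ W → ℝ
  muW_nonneg : ∀ q a p, 0 ≤ muW q a p
  muW_sum : ∀ q, ∑ a, ∑ p, muW q a p = 1
  /-- The initial distribution. -/
  sigma : R ⊕ W → ℝ
  sigma_nonneg : ∀ p, 0 ≤ sigma p
  sigma_sum : ∑ p, sigma p = 1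

/-- The probability mass function with the given real weights. -/
def pmfOfReal {ι : Type} [Fintype ι] (f : ι → ℝ) (h0 : ∀ i, 0 ≤ f i) (h1 : ∑ i, f i = 1) :
    PMF ι :=
  PMF.ofFintype (fun i => ENNReal.ofReal (f i)) (by
    rw [← ENNReal.ofReal_sum_of_nonneg fun i _ => h0 i, h1, ENNReal.ofReal_one])

/-- A configuration of a computation: the current state, the number of input symbols read so far,
and the output written so far. -/
structure Config (α R W : Type) where
  state : R ⊕ W
  pos : ℕ
  out : List α

instance instMeasurableSpaceConfig (α R W : Type) : MeasurableSpace (Config α R W) := ⊤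

instance instDiscreteMeasurableSpaceConfig (α R W : Type) :
    DiscreteMeasurableSpace (Config α R W) := ⟨fun _ => trivial⟩

/-- The output of a run `c 0, c 1, …`: its `k`-th symbol is the `k`-th symbol of the earliest
configuration whose output is longer than `k`; the output ends before position `k` if there is no
such configuration. (In a run of an automaton the outputs extend one another.) -/
def runOutput {α R W : Type} (c : ℕ → Config α R W) : Str α :=
  ⟨fun k => by
      classical
      exact if h : ∃ n, k < (c n).out.length then (c (Nat.find h)).out[k]? else none, by
    classical
    intro k hk
    by_cases h : ∃ n, k < (c n).out.length
    · have hlt := Nat.find_spec h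
      simp only [dif_pos h] at hk
      rw [List.getElem?_eq_getElem hlt] at hk
      simp at hk
    · have h' : ¬ ∃ n, k + 1 < (c n).out.length := fun ⟨n, hn⟩ => h ⟨n, by omega⟩
      simp only [dif_neg h']⟩

theorem runOutput_get?_eq_some {α R W : Type} (c : ℕ → Config α R W) (k : ℕ) (a : α) :
    (runOutput c).get? k = some a ↔
      ∃ n, (c n).out[k]? = some a ∧ ∀ m < n, ¬ k < (c m).out.length := by
  classical
  have hdef : (runOutput c).get? k =
      if h : ∃ n, k < (c n).out.length then (c (Nat.find h)).out[k]? else none := rfl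
  rw [hdef]
  constructor
  · intro h
    split_ifs at h with hex
    exact ⟨Nat.find hex, h, fun m hm => Nat.find_min hex hm⟩
  · rintro ⟨n, hn, hmin⟩
    have hlt : k < (c n).out.length := (List.getElem?_eq_some_iff.1 hn).1
    have hex : ∃ n, k < (c n).out.length := ⟨n, hlt⟩
    have hfind : Nat.find hex = n := (Nat.find_eq_iff hex).2 ⟨hlt, hmin⟩
    rw [dif_pos hex, hfind, hn]

theorem measurable_runOutput {α R W : Type} [Countable α] :
    Measurable (runOutput : (ℕ → Config α R W) → Str α) := by
  rw [measurable_iff_comap_le]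
  change MeasurableSpace.comap _ (⨆ k : ℕ, _) ≤ _
  rw [MeasurableSpace.comap_iSup]
  refine iSup_le fun k => ?_
  rw [MeasurableSpace.comap_comp]
  rw [← measurable_iff_comap_le]
  let _ : MeasurableSpace (Option α) := ⊤
  have hm : ∀ (n : ℕ) (s : Set (Config α R W)),
      MeasurableSet {c : ℕ → Config α R W | c n ∈ s} := fun n s =>
    (measurable_pi_apply n : Measurable fun c : ℕ → Config α R W => c n)
      (MeasurableSet.of_discrete (s := s))
  have hsome : ∀ a : α,
      MeasurableSet {c : ℕ → Config α R W | (runOutput c).get? k = some a} := by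
    intro a
    simp only [runOutput_get?_eq_some, Set.ofPred_exists]
    refine MeasurableSet.iUnion fun n => ?_
    refine MeasurableSet.inter ?_ ?_
    · exact hm n {d : Config α R W | d.out[k]? = some a}
    · change MeasurableSet {c : ℕ → Config α R W | ∀ m, m < n → ¬ k < (c m).out.length}
      simp only [Set.ofPred_forall]
      refine MeasurableSet.iInter fun m => MeasurableSet.iInter fun _ => ?_
      exact hm m {d : Config α R W | ¬ k < d.out.length}
  refine measurable_to_countable' fun o => ?_
  cases o with
  | some a => exact hsome a
  | none =>
    have : ((fun s : Stream'.Seq α => s.get? k) ∘ (runOutput : (ℕ → Config α R W) → _)) ⁻¹' {none}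
        = (⋃ a : α, {c : ℕ → Config α R W | (runOutput c).get? k = some a})ᶜ := by
      ext c
      simp [Option.eq_none_iff_forall_ne_some]
    rw [this]
    exact (MeasurableSet.iUnion hsome).compl

namespace PFA

variable {α R W : Type} [Fintype α] [Fintype R] [Nonempty R] [Fintype W] [Nonempty W]

/-- One transition on the infinite input `t`: an input state reads the next symbol of `t`, an
output state writes a symbol. -/
def stepPMF (X : PFA α R W) (t : ℕ → α) (c : Config α R W) : PMF (Config α R W) :=
  match c.state with
  | Sum.inl q =>
      (pmfOfReal (X.muR q (t c.pos)) (X.muR_nonneg q _) (X.muR_sum q _)).map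
        fun p => ⟨p, c.pos + 1, c.out⟩
  | Sum.inr q =>
      (pmfOfReal (fun z : α × (R ⊕ W) => X.muW q z.1 z.2) (fun z => X.muW_nonneg q z.1 z.2)
          (by rw [Fintype.sum_prod_type]; exact X.muW_sum q)).map
        fun z => ⟨z.2, c.pos, c.out ++ [z.1]⟩

/-- The law of the initial configuration. -/
def initPMF (X : PFA α R W) : PMF (Config α R W) :=
  (pmfOfReal X.sigma X.sigma_nonneg X.sigma_sum).map fun p => ⟨p, 0, []⟩

/-- The transition kernel of the Markov chain of configurations on the input `t`. -/
def stepKernel (X : PFA α R W) (t : ℕ → α) : Kernel (Config α R W) (Config α R W) :=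
  ⟨fun c => (X.stepPMF t c).toMeasure, measurable_from_top⟩

instance (X : PFA α R W) (t : ℕ → α) : IsMarkovKernel (X.stepKernel t) :=
  ⟨fun c => (inferInstance : IsProbabilityMeasure (X.stepPMF t c).toMeasure)⟩

/-- The transition kernels as functions of the history, of which only the last configuration
matters. -/
def historyKernel (X : PFA α R W) (t : ℕ → α) (n : ℕ) :
    Kernel (Finset.Iic n → Config α R W) (Config α R W) :=
  (X.stepKernel t).comap (fun h => h ⟨n, Finset.mem_Iic.2 le_rfl⟩) (measurable_pi_apply _)

instance (X : PFA α R W) (t : ℕ → α) (n : ℕ) : IsMarkovKernel (X.historyKernel t n) := by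
  unfold historyKernel; infer_instance

/-- The law of the random computation of `X` on the infinite input `t`, as a sequence of
configurations. -/
def runLaw (X : PFA α R W) (t : ℕ → α) : Measure (ℕ → Config α R W) :=
  Kernel.trajMeasure (X := fun _ => Config α R W) X.initPMF.toMeasure (X.historyKernel t)

instance (X : PFA α R W) (t : ℕ → α) : IsProbabilityMeasure (X.runLaw t) := by
  unfold runLaw; infer_instance

/-- The perturbation function computed by a probabilistic finite automaton: `t` is mapped to the
output of the random computation on `t`. -/
def perturbation (X : PFA α R W) : Perturbation α := fun t =>
  ⟨(X.runLaw t).map runOutput,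
    Measure.isProbabilityMeasure_map measurable_runOutput.aemeasurable⟩

end PFA

/-- The output states of the automaton for edit perturbations; each one remembers the symbol that
has been read. -/
inductive EditState : Type
  | sub (a : Bool)
  | ins (a : Bool)
  | del (a : Bool)
  deriving DecidableEq, Fintype

instance : Nonempty EditState := ⟨EditState.sub false⟩

/-- Reading probabilities: with probability `vS`, `vI`, `vD` the symbol `a` undergoes a
substitution, insertion or deletion perturbation; in the last case it is deleted with
probability `pD`. -/
def editRead (pD vS vI vD : ℝ) (a : Bool) : Unit ⊕ EditState → ℝ
  | Sum.inl () => vD * pD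
  | Sum.inr (EditState.sub b) => if b = a then vS else 0
  | Sum.inr (EditState.ins b) => if b = a then vI else 0
  | Sum.inr (EditState.del b) => if b = a then vD * (1 - pD) else 0

/-- Writing probabilities `editWrite pS pI qI q c p` (write `c`, move to `p`). The states `sub a`
and `del a` write one symbol and return, and `sub a` writes the opposite symbol `!a` with
probability `pS`. The state `ins a` writes a geometrically distributed number of symbols, each of
them `0` (`false`) with probability `qI`, and then writes `a` and returns. -/
def editWrite (pS pI qI : ℝ) : EditState → Bool → Unit ⊕ EditState → ℝ
  | EditState.sub a, c, p => if p = Sum.inl () then (if c = a then 1 - pS else pS) else 0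
  | EditState.ins a, c, p =>
      if p = Sum.inl () then (if c = a then pI else 0)
      else if p = Sum.inr (EditState.ins a) then (1 - pI) * (if c = false then qI else 1 - qI)
      else 0
  | EditState.del a, c, p => if p = Sum.inl () ∧ c = a then 1 else 0

theorem sum_editState (f : Unit ⊕ EditState → ℝ) :
    ∑ p, f p = f (Sum.inl ()) + (f (Sum.inr (.sub true)) + f (Sum.inr (.sub false)) +
      (f (Sum.inr (.ins true)) + f (Sum.inr (.ins false))) +
      (f (Sum.inr (.del true)) + f (Sum.inr (.del false)))) := by
  have hu : (Finset.univ : Finset EditState) =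
      {.sub true, .sub false, .ins true, .ins false, .del true, .del false} := by decide
  rw [Fintype.sum_sum_type, hu]
  simp
  ring

/-- The automaton `Y` for the convex combination, with weights `vS, vI, vD`, of the binary
substitution, insertion and deletion perturbations. It has a single input state, in which it
starts. -/
def editPFA (pS pI qI pD vS vI vD : ℝ)
    (hpS : pS ∈ Set.Ioo (0 : ℝ) 1) (hpI : pI ∈ Set.Ioo (0 : ℝ) 1)
    (hqI : qI ∈ Set.Ioo (0 : ℝ) 1) (hpD : pD ∈ Set.Ioo (0 : ℝ) 1)
    (hvS : vS ∈ Set.Icc (0 : ℝ) 1) (hvI : vI ∈ Set.Icc (0 : ℝ) 1)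
    (hvD : vD ∈ Set.Icc (0 : ℝ) 1) (hv : vS + vI + vD = 1) :
    PFA Bool Unit EditState where
  muR _ := editRead pD vS vI vD
  muR_nonneg := by
    obtain ⟨h1, h2⟩ := hpD
    have h3 : 0 ≤ vD * pD := mul_nonneg hvD.1 h1.le
    have h4 : 0 ≤ vD * (1 - pD) := mul_nonneg hvD.1 (by linarith)
    have h5 := hvS.1
    have h6 := hvI.1
    rintro _ a (_ | _ | _ | _) <;> simp only [editRead] <;>
      (try split_ifs) <;> first | assumption | exact le_rfl
  muR_sum := by
    rintro _ (_ | _) <;> rw [sum_editState] <;> simp [editRead] <;> linarith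
  muW := editWrite pS pI qI
  muW_nonneg := by
    obtain ⟨h1, h2⟩ := hpS
    obtain ⟨h3, h4⟩ := hpI
    obtain ⟨h5, h6⟩ := hqI
    have h7 : 0 ≤ (1 - pI) * qI := mul_nonneg (by linarith) h5.le
    have h8 : 0 ≤ (1 - pI) * (1 - qI) := mul_nonneg (by linarith) (by linarith)
    rintro (a | a | a) c p <;> simp only [editWrite] <;> split_ifs <;> linarith
  muW_sum := by
    rintro ((_ | _) | (_ | _) | (_ | _)) <;> simp only [sum_editState] <;>
      simp [editWrite] <;> ring
  sigma := Sum.elim (fun _ => 1) (fun _ => 0)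
  sigma_nonneg := by rintro (_ | _) <;> simp
  sigma_sum := by simp

end SmoothedTrie

end

noncomputable section

namespace SmoothedTrie

/-! Everything rests on how much mass a perturbed string can put on a single cylinder.

If `vD < 1`, each written symbol is unpredictable often enough that every finite word `w` is a
prefix of `Y(t)` with probability at most `K * ρ ^ w.length`, where `ρ < 1` and `K` do not depend on
`t` (`exists_perturbation_cylinder_le`). The bound comes from a supermartingale: a state weight
times `ρ` to the number of symbols of `w` still missing (`PFA.lintegral_prefixPotential_le`, with
weights for the edit automaton obtained from `exists_edit_contraction`). Two independent outputs
then share a prefix of length `m` with probability at most `K * ρ ^ m` (`pi_commonPrefix_le`). A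
union bound over fewer than `n ^ 2` ordered pairs and a geometric tail sum beyond `M ≈ 2 log n / log
(1 / ρ)` give an expected height of order `log n` (`exists_smoothedTrieHeight_le_log`).

If `vD = 1`, symbols are only deleted, so a long enough initial run of zeros leaves at least `k`
zeros with probability at least `3 / 4` (`exists_compl_cylinder_le`). Distinct inputs may share
arbitrarily long runs of zeros, so the expected height of a pair is at least `k / 2` for every `k`,
and the supremum is infinite as soon as `n ≥ 2` (`smoothedTrieHeight_eq_top`). -/

/-! ### Integrals along the chain of configurations. -/

instance instCountableConfig {α R W : Type} [Countable α] [Countable R] [Countable W] :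
    Countable (Config α R W) :=
  Function.Injective.countable (f := fun c : Config α R W => (c.state, c.pos, c.out)) (by
    rintro ⟨s, p, o⟩ ⟨s', p', o'⟩ h
    simpa using h)

theorem lintegral_pmfOfReal_map {ι β : Type} [Fintype ι] [MeasurableSpace β]
    [DiscreteMeasurableSpace β] [Countable β] (f : ι → ℝ) (h0 : ∀ i, 0 ≤ f i)
    (h1 : ∑ i, f i = 1) (g : ι → β) (F : β → ℝ≥0∞) :
    ∫⁻ b, F b ∂((pmfOfReal f h0 h1).map g).toMeasure = ∑ i, ENNReal.ofReal (f i) * F (g i) := by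
  let _ : MeasurableSpace ι := ⊤
  have : DiscreteMeasurableSpace ι := ⟨fun _ => trivial⟩
  have : MeasurableSingletonClass β := inferInstance
  rw [← PMF.toMeasure_map (p := pmfOfReal f h0 h1) (f := g) Measurable.of_discrete]
  rw [lintegral_map Measurable.of_discrete Measurable.of_discrete, lintegral_fintype]
  refine Finset.sum_congr rfl fun i _ => ?_
  rw [PMF.toMeasure_apply_singleton _ _ (MeasurableSet.of_discrete), mul_comm]
  rfl

namespace PFA

variable {α R W : Type} [Fintype α] [Fintype R] [Nonempty R] [Fintype W] [Nonempty W]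

theorem lintegral_stepPMF_inl (X : PFA α R W) (t : ℕ → α) (F : Config α R W → ℝ≥0∞)
    (q : R) (k : ℕ) (o : List α) :
    ∫⁻ d, F d ∂(X.stepPMF t ⟨Sum.inl q, k, o⟩).toMeasure =
      ∑ p, ENNReal.ofReal (X.muR q (t k) p) * F ⟨p, k + 1, o⟩ :=
  lintegral_pmfOfReal_map _ _ _ _ F

theorem lintegral_stepPMF_inr (X : PFA α R W) (t : ℕ → α) (F : Config α R W → ℝ≥0∞)
    (q : W) (k : ℕ) (o : List α) :
    ∫⁻ d, F d ∂(X.stepPMF t ⟨Sum.inr q, k, o⟩).toMeasure =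
      ∑ a, ∑ p, ENNReal.ofReal (X.muW q a p) * F ⟨p, k, o ++ [a]⟩ :=
  (lintegral_pmfOfReal_map _ _ _ _ F).trans (Fintype.sum_prod_type _)

theorem lintegral_runLaw_zero (X : PFA α R W) (t : ℕ → α) (F : Config α R W → ℝ≥0∞) :
    ∫⁻ c, F (c 0) ∂X.runLaw t = ∑ p, ENNReal.ofReal (X.sigma p) * F ⟨p, 0, []⟩ := by
  have h : (X.runLaw t).map (fun c => c 0) = X.initPMF.toMeasure := by
    have h1 : (fun c : ℕ → Config α R W => c 0) =
        (fun h : Finset.Iic 0 → Config α R W => h ⟨0, Finset.mem_Iic.2 le_rfl⟩) ∘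
          Preorder.frestrictLe (π := fun _ => Config α R W) 0 := rfl
    rw [h1, ← Measure.map_map (measurable_pi_apply _) (by fun_prop)]
    rw [runLaw, Kernel.trajMeasure, Measure.map_comp _ _ (by fun_prop),
      Kernel.traj_map_frestrictLe, Kernel.partialTraj_self, Measure.id_comp,
      Measure.map_map (measurable_pi_apply _) (by fun_prop)]
    exact Measure.map_id
  have h2 : ∫⁻ c, F (c 0) ∂X.runLaw t = ∫⁻ d, F d ∂(X.runLaw t).map (fun c => c 0) :=
    (lintegral_map Measurable.of_discrete (measurable_pi_apply 0)).symm
  rw [h2, h]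
  exact lintegral_pmfOfReal_map _ _ _ _ F

/-- The Markov property in integrated form; all later facts about runs need only two consecutive
configurations. -/
theorem lintegral_runLaw_succ (X : PFA α R W) (t : ℕ → α) (n : ℕ)
    (F : Config α R W → Config α R W → ℝ≥0∞) :
    ∫⁻ c, F (c n) (c (n + 1)) ∂X.runLaw t =
      ∫⁻ c, ∫⁻ d, F (c n) d ∂(X.stepPMF t (c n)).toMeasure ∂X.runLaw t := by
  have h := Kernel.map_frestrictLe_trajMeasure_compProd_eq_map_trajMeasure
    (X := fun _ => Config α R W) (μ₀ := X.initPMF.toMeasure) (κ := X.historyKernel t) (a := n)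
  let G : (Finset.Iic n → Config α R W) × Config α R W → ℝ≥0∞ :=
    fun z => F (z.1 ⟨n, Finset.mem_Iic.2 le_rfl⟩) z.2
  have hG : Measurable G := by
    -- Countability of the configurations makes their product with itself discrete.
    have h1 : Measurable (fun z : Config α R W × Config α R W => F z.1 z.2) :=
      Measurable.of_discrete
    have h2 : Measurable (fun h : Finset.Iic n → Config α R W =>
        h ⟨n, Finset.mem_Iic.2 le_rfl⟩) := measurable_pi_apply _
    exact h1.comp ((h2.comp measurable_fst).prodMk measurable_snd)
  have h2 : ∫⁻ z, G z ∂_ = ∫⁻ z, G z ∂_ := congrArg (fun μ => ∫⁻ z, G z ∂μ) h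
  rw [Measure.lintegral_compProd hG, lintegral_map hG (by fun_prop),
    lintegral_map hG.lintegral_kernel_prod_right' (by fun_prop)] at h2
  exact h2.symm

/-- Iterated one-step drift. It is applied with `r = 1` for word prefixes and with `r < 1` for
deletions; the latter use a potential that depends on time. -/
theorem lintegral_runLaw_le (X : PFA α R W) (t : ℕ → α) (r : ℝ≥0∞)
    (F : ℕ → Config α R W → ℝ≥0∞) (N : ℕ)
    (hF : ∀ n < N, ∀ c, ∫⁻ d, F (n + 1) d ∂(X.stepPMF t c).toMeasure ≤ r * F n c) :
    ∫⁻ c, F N (c N) ∂X.runLaw t ≤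
      r ^ N * ∑ p, ENNReal.ofReal (X.sigma p) * F 0 ⟨p, 0, []⟩ := by
  induction N with
  | zero => simp [lintegral_runLaw_zero X t (F 0)]
  | succ N ih =>
    rw [lintegral_runLaw_succ X t N fun _ d => F (N + 1) d]
    calc _ ≤ ∫⁻ c, r * F N (c N) ∂X.runLaw t := lintegral_mono fun c => hF N (by omega) _
      _ = r * ∫⁻ c, F N (c N) ∂X.runLaw t := lintegral_const_mul _
        ((Measurable.of_discrete (f := F N)).comp (measurable_pi_apply N))
      _ ≤ _ := by
        rw [pow_succ', mul_assoc]
        gcongr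
        exact ih fun n hn => hF n (by omega)

/-- The space of trajectories contains all sequences of configurations, so monotonicity of the
output holds only almost surely: the indicator of its failure has one-step integral zero. -/
theorem ae_out_prefix_succ (X : PFA α R W) (t : ℕ → α) :
    ∀ᵐ c ∂X.runLaw t, ∀ n, (c n).out <+: (c (n + 1)).out := by
  classical
  refine ae_all_iff.2 fun n => ?_
  have h := lintegral_runLaw_succ X t n fun c d => if c.out <+: d.out then 0 else 1
  have h0 : ∀ c : Config α R W,
      ∫⁻ d, (if c.out <+: d.out then 0 else 1) ∂(X.stepPMF t c).toMeasure = 0 := by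
    rintro ⟨q | q, k, o⟩
    · rw [lintegral_stepPMF_inl]; simp
    · rw [lintegral_stepPMF_inr]; simp
  simp only [h0, lintegral_zero] at h
  rw [lintegral_eq_zero_iff] at h
  · filter_upwards [h] with c hc
    by_contra hcon
    simp [hcon] at hc
  · have h1 : Measurable (fun z : Config α R W × Config α R W =>
        if z.1.out <+: z.2.out then (0 : ℝ≥0∞) else 1) := Measurable.of_discrete
    have h2 : Measurable (fun c : ℕ → Config α R W => (c n, c (n + 1))) :=
      (measurable_pi_apply n).prodMk (measurable_pi_apply (n + 1))
    exact h1.comp h2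

end PFA

/-! ### Cylinders and their probabilities. -/

/-- The strings with the finite prefix `w`. -/
def cylinder {α : Type} (w : List α) : Set (Str α) := {x | ∀ k < w.length, x.get? k = w[k]?}

theorem measurable_get? {α : Type} (k : ℕ) :
    Measurable[_, ⊤] (fun x : Str α => x.get? k) :=
  measurable_iff_comap_le.2 (le_iSup (fun k : ℕ =>
    MeasurableSpace.comap (fun s : Stream'.Seq α => s.get? k) ⊤) k)

theorem measurableSet_cylinder {α : Type} (w : List α) : MeasurableSet (cylinder w) := by
  have h : cylinder w = ⋂ k : ℕ, ⋂ _ : k < w.length, (fun x : Str α => x.get? k) ⁻¹' {w[k]?} := by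
    ext x; simp [cylinder]
  rw [h]
  exact MeasurableSet.iInter fun k => MeasurableSet.iInter fun _ => measurable_get? k trivial

theorem runOutput_mem_cylinder_iff {α R W : Type} {c : ℕ → Config α R W}
    (hc : ∀ n, (c n).out <+: (c (n + 1)).out) (w : List α) :
    runOutput c ∈ cylinder w ↔ ∃ N, w <+: (c N).out := by
  classical
  have hmono : ∀ {m n}, m ≤ n → (c m).out <+: (c n).out := fun {m n} h =>
    Nat.le_induction (List.prefix_refl _) (fun n _ ih => ih.trans (hc n)) n h
  constructor
  · intro h
    have h1 : ∀ k, ∃ n, k < w.length → (c n).out[k]? = w[k]? := by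
      intro k
      by_cases hk : k < w.length
      · have h2 := h k hk
        rw [List.getElem?_eq_getElem hk, runOutput_get?_eq_some] at h2
        obtain ⟨n, hn, -⟩ := h2
        exact ⟨n, fun _ => by rw [hn, List.getElem?_eq_getElem hk]⟩
      · exact ⟨0, fun h => absurd h hk⟩
    choose n hn using h1
    refine ⟨(Finset.range w.length).sup n, List.prefix_iff_getElem?.2 fun k hk => ?_⟩
    have h2 := hmono (Finset.le_sup (f := n) (Finset.mem_range.2 hk))
    have h3 := hn k hk
    rw [List.getElem?_eq_getElem hk] at h3
    obtain ⟨h4, h5⟩ := List.getElem?_eq_some_iff.1 h3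
    rw [← h5]
    exact List.prefix_iff_getElem?.1 h2 k h4
  · rintro ⟨N, hN⟩ k hk
    have h1 := List.prefix_iff_getElem?.1 hN k hk
    have hex : ∃ n, k < (c n).out.length := ⟨N, (List.getElem?_eq_some_iff.1 h1).1⟩
    rw [List.getElem?_eq_getElem hk, runOutput_get?_eq_some]
    refine ⟨Nat.find hex, ?_, fun m hm => Nat.find_min hex hm⟩
    have h2 := hmono (Nat.find_min' hex (List.getElem?_eq_some_iff.1 h1).1)
    have h3 := List.prefix_iff_getElem?.1 h2 k (Nat.find_spec hex)
    rw [List.getElem?_eq_getElem (Nat.find_spec hex), ← h3, h1]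

namespace PFA

variable {α R W : Type} [Fintype α] [Fintype R] [Nonempty R] [Fintype W] [Nonempty W]

/-- Continuity from below. The events on the right increase only almost surely, so they are first
replaced by their unions over times up to `N`. -/
theorem perturbation_cylinder (X : PFA α R W) (t : ℕ → α) (w : List α) :
    (X.perturbation t : Measure (Str α)) (cylinder w) =
      ⨆ N, X.runLaw t {c | w <+: (c N).out} := by
  have h1 : (X.perturbation t : Measure (Str α)) (cylinder w) =
      X.runLaw t (runOutput ⁻¹' cylinder w) :=
    Measure.map_apply measurable_runOutput (measurableSet_cylinder w)
  have h2 : X.runLaw t (runOutput ⁻¹' cylinder w) =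
      X.runLaw t (⋃ N, ⋃ n ∈ Set.Iic N, {c | w <+: (c n).out}) := by
    refine measure_congr ?_
    filter_upwards [X.ae_out_prefix_succ t] with c hc
    refine propext ((runOutput_mem_cylinder_iff hc w).trans ?_)
    constructor
    · rintro ⟨N, h⟩
      exact Set.mem_iUnion.2 ⟨N, Set.mem_biUnion (Set.mem_Iic.2 le_rfl) h⟩
    · intro h
      obtain ⟨N, h⟩ := Set.mem_iUnion.1 h
      obtain ⟨n, -, h⟩ := Set.mem_iUnion₂.1 h
      exact ⟨n, h⟩
  rw [h1, h2, Monotone.measure_iUnion]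
  · refine iSup_congr fun N => measure_congr ?_
    filter_upwards [X.ae_out_prefix_succ t] with c hc
    refine propext ⟨fun h => ?_, fun h => Set.mem_biUnion (Set.mem_Iic.2 le_rfl) h⟩
    obtain ⟨n, hn, h⟩ := Set.mem_iUnion₂.1 h
    exact List.IsPrefix.trans h
      (Nat.le_induction (List.prefix_refl _) (fun n _ ih => ih.trans (hc n)) N hn)
  · exact fun m n h => Set.biUnion_subset_biUnion_left (Set.Iic_subset_Iic.2 h)

end PFA

/-! ### Exponential decay of cylinder probabilities from state weights. -/

theorem sum_ofReal_mul_ofReal_le {ι : Type} [Fintype ι] {f e : ι → ℝ} {E x : ℝ}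
    (hf : ∀ i, 0 ≤ f i) (he : ∀ i, 0 ≤ e i) (hx : 0 ≤ x) (h : ∑ i, f i * e i ≤ E) :
    ∑ i, ENNReal.ofReal (f i) * ENNReal.ofReal (e i * x) ≤ ENNReal.ofReal (E * x) := by
  calc ∑ i, ENNReal.ofReal (f i) * ENNReal.ofReal (e i * x)
      = ENNReal.ofReal (∑ i, f i * (e i * x)) := by
        rw [ENNReal.ofReal_sum_of_nonneg fun i _ => mul_nonneg (hf i) (mul_nonneg (he i) hx)]
        exact Finset.sum_congr rfl fun i _ => (ENNReal.ofReal_mul (hf i)).symm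
    _ ≤ _ := by
        refine ENNReal.ofReal_le_ofReal ?_
        simp_rw [← mul_assoc, ← Finset.sum_mul]
        exact mul_le_mul_of_nonneg_right h hx

namespace PFA

variable {α R W : Type} [Fintype α] [Fintype R] [Nonempty R] [Fintype W] [Nonempty W]

open Classical in
/-- An upper bound for the probability that the output of a computation in configuration `c` will
have the prefix `w`, if each correct symbol costs a factor `ρ` up to the state weights `e`. -/
def prefixPotential (e : R ⊕ W → ℝ) (ρ : ℝ) (w : List α) (c : Config α R W) : ℝ≥0∞ :=
  if w <+: c.out then 1
  else if c.out <+: w then ENNReal.ofReal (e c.state * ρ ^ (w.length - c.out.length))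
  else 0

/-- A completed `w` stays completed and a mismatch is never repaired, so only proper prefixes of `w`
matter. There `hR` controls reading, and `hW` pays the factor `ρ` for the one symbol that continues
`w`. -/
theorem lintegral_prefixPotential_le (X : PFA α R W) {e : R ⊕ W → ℝ} {ρ : ℝ} (hρ : 0 ≤ ρ)
    (he : ∀ p, 1 ≤ e p) (hR : ∀ q a, ∑ p, X.muR q a p * e p ≤ e (Sum.inl q))
    (hW : ∀ q b, ∑ p, X.muW q b p * e p ≤ ρ * e (Sum.inr q)) (t : ℕ → α) (w : List α)
    (c : Config α R W) :
    ∫⁻ d, prefixPotential e ρ w d ∂(X.stepPMF t c).toMeasure ≤ prefixPotential e ρ w c := by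
  classical
  have he0 : ∀ p, 0 ≤ e p := fun p => zero_le_one.trans (he p)
  by_cases h1 : w <+: c.out
  · have h2 : prefixPotential e ρ w c = 1 := by simp [prefixPotential, h1]
    rw [h2]
    obtain ⟨q | q, k, o⟩ := c
    · rw [lintegral_stepPMF_inl]
      have h4 : ∀ p, prefixPotential e ρ w ⟨p, k + 1, o⟩ = 1 := fun p => by
        simpa [prefixPotential] using fun h => absurd h1 h
      simp_rw [h4, mul_one]
      rw [← ENNReal.ofReal_sum_of_nonneg fun p _ => X.muR_nonneg _ _ _, X.muR_sum,
        ENNReal.ofReal_one]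
    · rw [lintegral_stepPMF_inr]
      have h4 : ∀ p a, prefixPotential e ρ w ⟨p, k, o ++ [a]⟩ = 1 := fun p a => by
        have : w <+: o ++ [a] := h1.trans (List.prefix_append _ _)
        simp [prefixPotential, this]
      simp_rw [h4, mul_one]
      simp_rw [← ENNReal.ofReal_sum_of_nonneg fun p _ => X.muW_nonneg _ _ p]
      rw [← ENNReal.ofReal_sum_of_nonneg
        fun a _ => Finset.sum_nonneg fun p _ => X.muW_nonneg _ _ _, X.muW_sum,
        ENNReal.ofReal_one]
  by_cases h2 : c.out <+: w
  · obtain ⟨v, rfl⟩ := h2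
    rcases v with _ | ⟨b, v⟩
    · simp at h1
    have h3 : prefixPotential e ρ (c.out ++ b :: v) c =
        ENNReal.ofReal (e c.state * ρ ^ (v.length + 1)) := by
      simp [prefixPotential, h1]
    rw [h3]
    obtain ⟨q | q, k, o⟩ := c
    · rw [lintegral_stepPMF_inl]
      simp only at h1 ⊢
      have h4 : ∀ p, prefixPotential e ρ (o ++ b :: v) ⟨p, k + 1, o⟩ =
          ENNReal.ofReal (e p * ρ ^ (v.length + 1)) := fun p => by
        simp [prefixPotential, h1]
      simp_rw [h4]
      exact sum_ofReal_mul_ofReal_le (fun p => X.muR_nonneg _ _ p) he0 (by positivity) (hR _ _)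
    · rw [lintegral_stepPMF_inr]
      simp only at h1 ⊢
      have h4 : ∀ p a, prefixPotential e ρ (o ++ b :: v) ⟨p, k, o ++ [a]⟩ ≤
          if a = b then ENNReal.ofReal (e p * ρ ^ v.length) else 0 := fun p a => by
        by_cases hab : a = b
        · subst hab
          rcases v with _ | ⟨b', v⟩
          -- Writing the last symbol of `w` sets the potential to `1`, whatever the new state; this
          -- is where weights at least `1` are needed.
          · simpa [prefixPotential] using he p
          · have : o.length + (v.length + 1 + 1) - (o.length + 1) = v.length + 1 := by omega
            simp [prefixPotential, this]
        · simp [prefixPotential, hab, Ne.symm hab]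
      calc _ ≤ ∑ a, ∑ p, ENNReal.ofReal (X.muW q a p) *
            (if a = b then ENNReal.ofReal (e p * ρ ^ v.length) else 0) := by
            gcongr with a _ p _
            exact h4 p a
        _ = ∑ p, ENNReal.ofReal (X.muW q b p) * ENNReal.ofReal (e p * ρ ^ v.length) := by
            rw [Finset.sum_eq_single b]
            · simp
            · intro a _ hab
              simp [hab]
            · simp
        _ ≤ ENNReal.ofReal (ρ * e (Sum.inr q) * ρ ^ v.length) :=
            sum_ofReal_mul_ofReal_le (fun p => X.muW_nonneg _ _ p) he0 (by positivity) (hW _ _)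
        _ = _ := by congr 1; ring
  · have h3 : prefixPotential e ρ w c = 0 := by simp [prefixPotential, h1, h2]
    rw [h3]
    obtain ⟨q | q, k, o⟩ := c
    · rw [lintegral_stepPMF_inl]
      simp_all [prefixPotential]
    · rw [lintegral_stepPMF_inr]
      simp only at h1 h2
      have h4 : ∀ p a, prefixPotential e ρ w ⟨p, k, o ++ [a]⟩ = 0 := fun p a => by
        have h5 : ¬ w <+: o ++ [a] := by
          rw [List.prefix_concat_iff]
          rintro (rfl | h)
          · exact h2 (List.prefix_append _ _)
          · exact h1 h
        have h6 : ¬ o ++ [a] <+: w := fun h => h2 ((List.prefix_append _ _).trans h)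
        simp [prefixPotential, h5, h6]
      simp [h4]

theorem perturbation_cylinder_le (X : PFA α R W) {e : R ⊕ W → ℝ} {ρ K : ℝ} (hρ : 0 ≤ ρ)
    (he : ∀ p, 1 ≤ e p) (heK : ∀ p, e p ≤ K)
    (hR : ∀ q a, ∑ p, X.muR q a p * e p ≤ e (Sum.inl q))
    (hW : ∀ q b, ∑ p, X.muW q b p * e p ≤ ρ * e (Sum.inr q)) (t : ℕ → α) (w : List α) :
    (X.perturbation t : Measure (Str α)) (cylinder w) ≤ ENNReal.ofReal (K * ρ ^ w.length) := by
  classical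
  rw [perturbation_cylinder]
  have hK : 1 ≤ K := (he (Classical.arbitrary _)).trans (heK _)
  refine iSup_le fun N => ?_
  have h1 : X.runLaw t {c | w <+: (c N).out} ≤
      ∫⁻ c, prefixPotential e ρ w (c N) ∂X.runLaw t := by
    have hm : MeasurableSet {c : ℕ → Config α R W | w <+: (c N).out} :=
      (measurable_pi_apply N : Measurable fun c : ℕ → Config α R W => c N)
        (MeasurableSet.of_discrete (s := {d : Config α R W | w <+: d.out}))
    rw [← lintegral_indicator_one hm]
    refine lintegral_mono fun c => ?_
    by_cases h : w <+: (c N).out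
    · simp [prefixPotential, h]
    · rw [Set.indicator_of_notMem (by exact h)]
      exact zero_le
  refine h1.trans ((X.lintegral_runLaw_le t 1 (fun _ => prefixPotential e ρ w) N
    fun n _ c => ?_).trans ?_)
  · rw [one_mul]
    exact X.lintegral_prefixPotential_le hρ he hR hW t w c
  · have h2 : ∀ p : R ⊕ W, prefixPotential e ρ w ⟨p, 0, []⟩ ≤
        ENNReal.ofReal (K * ρ ^ w.length) := fun p => by
      rcases w with _ | ⟨b, w⟩
      · simpa [prefixPotential] using hK
      · simp only [prefixPotential, List.prefix_nil, reduceCtorEq, if_false, List.nil_prefix,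
          if_true, List.length_nil, Nat.sub_zero]
        refine ENNReal.ofReal_le_ofReal ?_
        gcongr
        exact heK p
    calc _ ≤ 1 ^ N * ∑ p, ENNReal.ofReal (X.sigma p) * ENNReal.ofReal (K * ρ ^ w.length) := by
          gcongr with p _
          exact h2 p
      _ = _ := by
          rw [← Finset.sum_mul, ← ENNReal.ofReal_sum_of_nonneg fun p _ => X.sigma_nonneg p,
            X.sigma_sum]
          simp

end PFA

/-! ### State weights for the edit automaton. -/

/-- Here `σ` bounds the probability of a given symbol in a substitution, `τ` that of a given symbol
while the insertion continues, and `B` is the weight of an insertion state relative to the input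
state. At `ρ = 1` both final inequalities can be made strict, so they survive for some `ρ < 1`. -/
theorem exists_edit_contraction {pS pI qI pD vS vI vD : ℝ}
    (hpS : pS ∈ Set.Ioo (0 : ℝ) 1) (hpI : pI ∈ Set.Ioo (0 : ℝ) 1)
    (hqI : qI ∈ Set.Ioo (0 : ℝ) 1)
    (hvS : vS ∈ Set.Icc (0 : ℝ) 1) (hvI : vI ∈ Set.Icc (0 : ℝ) 1)
    (hv : vS + vI + vD = 1) (hD : vD < 1) :
    ∃ σ τ B ρ : ℝ, pS ≤ σ ∧ 1 - pS ≤ σ ∧ (1 - pI) * qI ≤ τ ∧ (1 - pI) * (1 - qI) ≤ τ ∧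
      0 < σ ∧ σ ≤ 1 ∧ 0 < B ∧ B ≤ 1 ∧ 0 < ρ ∧ ρ < 1 ∧ pI + τ * B ≤ ρ * B ∧
      vD * pD * ρ + vS * σ + vI * B * ρ + vD * (1 - pD) ≤ ρ := by
  obtain ⟨h1, h2⟩ := hpS
  obtain ⟨h3, h4⟩ := hpI
  obtain ⟨h5, h6⟩ := hqI
  set σ := max pS (1 - pS) with hσ
  set q := max qI (1 - qI) with hq
  set τ := (1 - pI) * q with hτ
  have hσ1 : σ < 1 := max_lt h2 (by linarith)
  have hσ0 : 0 < σ := lt_max_of_lt_left h1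
  have hq1 : q < 1 := max_lt h6 (by linarith)
  have hpI' : 0 < 1 - pI := by linarith
  have hτ1 : τ < 1 - pI := by
    have := mul_lt_mul_of_pos_left hq1 hpI'
    linarith
  -- The lower bound is the fixed point of `B = pI + τ * B`; it lies below `1` because `τ < 1 - pI`.
  obtain ⟨B, hB0, hB1⟩ : ∃ B, pI / (1 - τ) < B ∧ B < 1 :=
    exists_between ((div_lt_one (by linarith)).2 (by linarith))
  have hB : pI + τ * B < 1 * B := by
    rw [div_lt_iff₀ (by linarith)] at hB0
    linarith
  have hBpos : 0 < B := lt_of_le_of_lt (div_nonneg h3.le (by linarith)) hB0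
  have hlt : vD * pD * 1 + vS * σ + vI * B * 1 + vD * (1 - pD) < 1 := by
    have hS : vS * σ ≤ vS := by nlinarith [hvS.1]
    have hI : vI * B ≤ vI := by nlinarith [hvI.1]
    -- Strictness comes from `σ < 1` if `vS > 0`, and otherwise from `B < 1`, since then `vI = 1 -
    -- vD > 0`.
    rcases hvS.1.lt_or_eq with h | h
    · have : vS * σ < vS := by nlinarith
      nlinarith
    · have hvI0 : 0 < vI := by linarith
      have : vI * B < vI := by nlinarith
      nlinarith
  have e1 : ∀ᶠ ρ in nhds (1 : ℝ), pI + τ * B < ρ * B :=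
    ContinuousAt.eventually_lt (by fun_prop) (by fun_prop) hB
  have e2 : ∀ᶠ ρ in nhds (1 : ℝ), vD * pD * ρ + vS * σ + vI * B * ρ + vD * (1 - pD) < ρ :=
    ContinuousAt.eventually_lt (by fun_prop) (by fun_prop) hlt
  obtain ⟨ρ, ⟨ha, hb⟩, hc, hd⟩ := (((e1.and e2).filter_mono
    (nhdsWithin_le_nhds (s := Set.Iio 1))).and (Ioo_mem_nhdsLT (zero_lt_one (α := ℝ)))).exists
  exact ⟨σ, τ, B, ρ, le_max_left _ _, le_max_right _ _,
      mul_le_mul_of_nonneg_left (le_max_left _ _) hpI'.le,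
      mul_le_mul_of_nonneg_left (le_max_right _ _) hpI'.le,
      hσ0, hσ1.le, hBpos, hB1.le, hc, hd, ha.le, hb.le⟩

theorem exists_perturbation_cylinder_le (pS pI qI pD vS vI vD : ℝ)
    (hpS : pS ∈ Set.Ioo (0 : ℝ) 1) (hpI : pI ∈ Set.Ioo (0 : ℝ) 1)
    (hqI : qI ∈ Set.Ioo (0 : ℝ) 1) (hpD : pD ∈ Set.Ioo (0 : ℝ) 1)
    (hvS : vS ∈ Set.Icc (0 : ℝ) 1) (hvI : vI ∈ Set.Icc (0 : ℝ) 1)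
    (hvD : vD ∈ Set.Icc (0 : ℝ) 1) (hv : vS + vI + vD = 1) (hD : vD < 1) :
    ∃ ρ K : ℝ, 0 < ρ ∧ ρ < 1 ∧ 0 ≤ K ∧ ∀ t w,
      ((editPFA pS pI qI pD vS vI vD hpS hpI hqI hpD hvS hvI hvD hv).perturbation t :
        Measure (Str Bool)) (cylinder w) ≤ ENNReal.ofReal (K * ρ ^ w.length) := by
  obtain ⟨σ, τ, B, ρ, hσ1, hσ2, hτ1, hτ2, hσ0, hσ, hB0, hB1, hρ0, hρ1, hins, hread⟩ :=
    exists_edit_contraction (pD := pD) hpS hpI hqI hvS hvI hv hD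
  have hA : 1 ≤ 1 / (B * σ) := (one_le_div (by positivity)).2 (by nlinarith)
  -- Relative to the input state the weights are `σ / ρ`, `B` and `1 / ρ`, as the writing conditions
  -- suggest; the common factor `1 / (B * σ)` lifts all of them to at least `1`.
  let e : Unit ⊕ EditState → ℝ := fun p => match p with
    | Sum.inl _ => 1 / (B * σ)
    | Sum.inr (EditState.sub _) => 1 / (B * ρ)
    | Sum.inr (EditState.ins _) => 1 / σ
    | Sum.inr (EditState.del _) => 1 / (B * σ) / ρ
  have he : ∀ p, 1 ≤ e p := by
    rintro (_ | _ | _ | _)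
    · exact hA
    · exact (one_le_div (by positivity)).2 (by nlinarith)
    · exact (one_le_div (by positivity)).2 hσ
    · exact hA.trans (le_div_self (by positivity) hρ0 hρ1.le)
  refine ⟨ρ, ∑ p, e p, hρ0, hρ1, Finset.sum_nonneg fun p _ => zero_le_one.trans (he p),
    fun t w => PFA.perturbation_cylinder_le _ hρ0.le he (fun p => Finset.single_le_sum
      (fun p _ => zero_le_one.trans (he p)) (Finset.mem_univ p)) ?_ ?_ t w⟩
  · have key : vD * pD * (1 / (B * σ)) + (vS * (1 / (B * ρ)) + vI * (1 / σ) +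
        vD * (1 - pD) * (1 / (B * σ) / ρ)) ≤ 1 / (B * σ) := by
      have h1 : vD * pD * (1 / (B * σ)) + (vS * (1 / (B * ρ)) + vI * (1 / σ) +
          vD * (1 - pD) * (1 / (B * σ) / ρ)) =
          (vD * pD * ρ + vS * σ + vI * B * ρ + vD * (1 - pD)) / (B * σ * ρ) := by
        field_simp
        ring
      rw [h1, div_le_div_iff₀ (by positivity) (by positivity)]
      calc _ ≤ ρ * (B * σ) := mul_le_mul_of_nonneg_right hread (by positivity)
        _ = _ := by ring
    rintro _ (_ | _) <;> rw [sum_editState] <;> simpa [editPFA, editRead, e] using key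
  · have hsub : ∀ s, s ≤ σ → s * (1 / (B * σ)) ≤ ρ * (1 / (B * ρ)) := fun s hs => by
      have h1 : ρ * (1 / (B * ρ)) = 1 / B := by field_simp
      rw [h1, mul_one_div, div_le_div_iff₀ (by positivity) (by positivity)]
      nlinarith
    -- `s` is the probability of returning to the input state: `pI` for the remembered symbol, `0`
    -- for the other one.
    have hins' : ∀ s r, s ≤ pI → r ≤ τ → s * (1 / (B * σ)) + r * (1 / σ) ≤ ρ * (1 / σ) := by
      intro s r hs hr
      have h1 : s * (1 / (B * σ)) + r * (1 / σ) = (s + r * B) / (B * σ) := by field_simp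
      have h2 : ρ * (1 / σ) = (ρ * B) / (B * σ) := by field_simp
      rw [h1, h2]
      gcongr
      nlinarith
    have hdel : ρ * (1 / (B * σ) / ρ) = 1 / (B * σ) := by field_simp
    have hpI0 := hpI.1.le
    have hA0 : 0 ≤ 1 / (B * σ) := zero_le_one.trans hA
    rintro ((_ | _) | (_ | _) | (_ | _)) (_ | _) <;> rw [sum_editState] <;>
      simp only [editPFA, editWrite, e] <;>
      simp only [reduceCtorEq, if_true, if_false, zero_mul, add_zero, zero_add, Sum.inr.injEq,
        EditState.ins.injEq, Bool.false_eq_true, and_true, and_false,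
        hdel, one_mul, le_refl] <;>
      first
      | exact hsub _ hσ1
      | exact hsub _ hσ2
      | exact hins' _ _ le_rfl hτ1
      | exact hins' _ _ le_rfl hτ2
      | exact hA0
      | (refine le_trans (le_of_eq ?_) (hins' 0 _ hpI0 hτ1); ring1)
      | (refine le_trans (le_of_eq ?_) (hins' 0 _ hpI0 hτ2); ring1)

/-! ### From cylinder bounds to logarithmic height. -/

/-- The families of strings whose members `i` and `j` have a common prefix of length `m`. -/
def commonPrefix {α ι : Type} (i j : ι) (m : ℕ) : Set (ι → Str α) :=
  ⋃ w : Fin m → α,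
    (fun x => x i) ⁻¹' cylinder (List.ofFn w) ∩ (fun x => x j) ⁻¹' cylinder (List.ofFn w)

theorem measurableSet_commonPrefix {α ι : Type} [Finite α] (i j : ι) (m : ℕ) :
    MeasurableSet (commonPrefix i j m : Set (ι → Str α)) :=
  MeasurableSet.iUnion fun _ =>
    (measurable_pi_apply i (measurableSet_cylinder _)).inter
      (measurable_pi_apply j (measurableSet_cylinder _))

theorem mem_commonPrefix_of_lt_lcp {α ι : Type} {i j : ι} {m : ℕ} {x : ι → Str α}
    (h : (m : ℕ∞) < lcp (x i) (x j)) : x ∈ commonPrefix i j m := by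
  obtain ⟨m', h⟩ := lt_iSup_iff.1 h
  obtain ⟨hm', h⟩ := lt_iSup_iff.1 h
  have hlt : m < m' := by exact_mod_cast h
  choose a ha using fun k : Fin m => hm' k (k.2.trans hlt)
  refine Set.mem_iUnion.2 ⟨a, fun k hk => ?_, fun k hk => ?_⟩ <;>
    rw [List.getElem?_eq_getElem hk, List.getElem_ofFn]
  · exact (ha ⟨k, by simpa using hk⟩).1
  · exact (ha ⟨k, by simpa using hk⟩).2

theorem disjoint_cylinder {α : Type} {v w : List α} (hl : v.length = w.length) (h : v ≠ w) :
    Disjoint (cylinder v) (cylinder w) := by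
  refine Set.disjoint_left.2 fun x hx hy => h (List.ext_getElem? fun k => ?_)
  by_cases hk : k < v.length
  · rw [← hx k hk, hy k (hl ▸ hk)]
  · rw [List.getElem?_eq_none (not_lt.1 hk), List.getElem?_eq_none (hl ▸ not_lt.1 hk)]

/-- By independence the probability is a sum of products over words of length `m`. One factor is at
most `b`; the other sums to at most `1` because these cylinders are disjoint. No bound on `μ j` is
needed. -/
theorem pi_commonPrefix_le {α ι : Type} [Finite α] [Fintype ι] (μ : ι → Measure (Str α))
    [∀ i, IsProbabilityMeasure (μ i)] {i j : ι} (hij : i ≠ j) (m : ℕ) (b : ℝ≥0∞)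
    (hb : ∀ w : List α, w.length = m → μ i (cylinder w) ≤ b) :
    Measure.pi μ (commonPrefix i j m) ≤ b := by
  have := Fintype.ofFinite α
  have hind : IndepFun (fun x : ι → Str α => x i) (fun x => x j) (Measure.pi μ) :=
    (iIndepFun_pi (μ := μ) (X := fun _ => id) fun _ => aemeasurable_id).indepFun hij
  have hpre : ∀ (l : ι) (w : List α),
      Measure.pi μ ((fun x : ι → Str α => x l) ⁻¹' cylinder w) = μ l (cylinder w) := fun l w =>
    (measurePreserving_eval μ l).measure_preimage (measurableSet_cylinder w).nullMeasurableSet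
  calc Measure.pi μ (commonPrefix i j m)
      ≤ ∑ w : Fin m → α, Measure.pi μ ((fun x => x i) ⁻¹' cylinder (List.ofFn w) ∩
          (fun x => x j) ⁻¹' cylinder (List.ofFn w)) := measure_iUnion_fintype_le _ _
    _ = ∑ w : Fin m → α, μ i (cylinder (List.ofFn w)) * μ j (cylinder (List.ofFn w)) := by
        refine Finset.sum_congr rfl fun w _ => ?_
        rw [hind.measure_inter_preimage_eq_mul _ _ (measurableSet_cylinder _)
          (measurableSet_cylinder _), hpre, hpre]
    _ ≤ ∑ w : Fin m → α, b * μ j (cylinder (List.ofFn w)) := by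
        gcongr with w
        exact hb _ (List.length_ofFn)
    _ = b * μ j (⋃ w : Fin m → α, cylinder (List.ofFn w)) := by
        rw [← Finset.mul_sum, measure_iUnion _ fun w => measurableSet_cylinder _, tsum_fintype]
        intro v w hvw
        exact disjoint_cylinder (by simp) fun h => hvw (List.ofFn_injective h)
    _ ≤ b * 1 := by gcongr; exact prob_le_one
    _ = b := mul_one b

/-- The layer-cake sum with its first `M` terms bounded by `1`; for `h = ⊤` the series diverges. -/
theorem enat_le_add_tsum (h : ℕ∞) (M : ℕ) :
    (h : ℝ≥0∞) ≤ M + ∑' k : ℕ, if ((M + k : ℕ) : ℕ∞) < h then 1 else 0 := by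
  induction h using ENat.recTopCoe with
  | top => simp
  | coe n =>
    have h1 : ((n - M : ℕ) : ℝ≥0∞) ≤
        ∑' k : ℕ, if ((M + k : ℕ) : ℕ∞) < (n : ℕ∞) then 1 else 0 := by
      refine le_trans (le_of_eq ?_) (ENNReal.sum_le_tsum (Finset.range (n - M)))
      rw [Finset.sum_congr rfl (g := fun _ => (1 : ℝ≥0∞))]
      · simp
      · intro k hk
        have : M + k < n := by have := Finset.mem_range.1 hk; omega
        rw [if_pos (by exact_mod_cast this)]
    calc ((n : ℕ∞) : ℝ≥0∞) ≤ ((M + (n - M) : ℕ) : ℝ≥0∞) := by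
          rw [ENat.toENNReal_coe]; exact_mod_cast (by omega : n ≤ M + (n - M))
      _ ≤ _ := by rw [Nat.cast_add]; exact add_le_add_right h1 _

theorem trieHeight_le_add_tsum {α ι : Type} [Fintype ι] [DecidableEq ι] (x : ι → Str α) (M : ℕ) :
    (trieHeight x : ℝ≥0∞) ≤ M + ∑' k : ℕ, ∑ p ∈ Finset.univ.offDiag,
      (commonPrefix p.1 p.2 (M + k)).indicator (1 : (ι → Str α) → ℝ≥0∞) x := by
  refine (enat_le_add_tsum _ M).trans ?_
  gcongr with k
  split_ifs with h
  · obtain ⟨i, h⟩ := lt_iSup_iff.1 h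
    obtain ⟨j, h⟩ := lt_iSup_iff.1 h
    obtain ⟨hij, h⟩ := lt_iSup_iff.1 h
    have hmem : (i, j) ∈ (Finset.univ : Finset ι).offDiag := by simpa using hij
    calc (1 : ℝ≥0∞) = (commonPrefix i j (M + k)).indicator (1 : (ι → Str α) → ℝ≥0∞) x := by
          rw [Set.indicator_of_mem (mem_commonPrefix_of_lt_lcp h)]; rfl
      _ ≤ _ := Finset.single_le_sum (f := fun p : ι × ι =>
            (commonPrefix p.1 p.2 (M + k)).indicator (1 : (ι → Str α) → ℝ≥0∞) x)
            (fun _ _ => zero_le) hmem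
  · exact zero_le

theorem lintegral_trieHeight_le {α ι : Type} [Finite α] [Fintype ι] (μ : ι → Measure (Str α))
    [∀ i, IsProbabilityMeasure (μ i)] {ρ K : ℝ} (hρ0 : 0 < ρ) (hρ1 : ρ < 1) (hK : 0 ≤ K)
    (h : ∀ i w, μ i (cylinder w) ≤ ENNReal.ofReal (K * ρ ^ w.length)) (M : ℕ) :
    ∫⁻ x, (trieHeight x : ℝ≥0∞) ∂Measure.pi μ ≤
      ENNReal.ofReal (M + (Fintype.card ι : ℝ) ^ 2 * ρ ^ M * (K / (1 - ρ))) := by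
  classical
  have hm : ∀ (k : ℕ) (p : ι × ι), Measurable
      ((commonPrefix p.1 p.2 (M + k)).indicator (1 : (ι → Str α) → ℝ≥0∞)) := fun k p =>
    measurable_one.indicator (measurableSet_commonPrefix _ _ _)
  have hterm : ∀ (k : ℕ), ∀ p ∈ (Finset.univ : Finset ι).offDiag,
      ∫⁻ x, (commonPrefix p.1 p.2 (M + k)).indicator (1 : (ι → Str α) → ℝ≥0∞) x ∂Measure.pi μ
        ≤ ENNReal.ofReal (K * ρ ^ (M + k)) := by
    intro k p hp
    rw [lintegral_indicator_one (measurableSet_commonPrefix _ _ _)]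
    exact pi_commonPrefix_le μ (Finset.mem_offDiag.1 hp).2.2 _ _ fun w hw => hw ▸ h p.1 w
  have hsum : HasSum (fun k : ℕ => (Fintype.card ι : ℝ) ^ 2 * (K * ρ ^ (M + k)))
      ((Fintype.card ι : ℝ) ^ 2 * ρ ^ M * (K / (1 - ρ))) := by
    have h1 := (hasSum_geometric_of_lt_one hρ0.le hρ1).mul_left
      ((Fintype.card ι : ℝ) ^ 2 * ρ ^ M * K)
    rw [div_eq_mul_inv, ← mul_assoc]
    refine h1.congr_fun fun k => ?_
    ring
  calc ∫⁻ x, (trieHeight x : ℝ≥0∞) ∂Measure.pi μ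
      ≤ ∫⁻ x, M + ∑' k : ℕ, ∑ p ∈ Finset.univ.offDiag,
          (commonPrefix p.1 p.2 (M + k)).indicator (1 : (ι → Str α) → ℝ≥0∞) x ∂Measure.pi μ :=
        lintegral_mono fun x => trieHeight_le_add_tsum x M
    _ = M + ∑' k : ℕ, ∑ p ∈ Finset.univ.offDiag, ∫⁻ x,
          (commonPrefix p.1 p.2 (M + k)).indicator (1 : (ι → Str α) → ℝ≥0∞) x ∂Measure.pi μ := by
        rw [lintegral_add_left measurable_const, lintegral_const, measure_univ, mul_one,
          lintegral_tsum fun k => (Finset.measurable_sum _ fun p _ => hm k p).aemeasurable]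
        congr 1
        exact tsum_congr fun k => lintegral_finsetSum _ fun p _ => hm k p
    _ ≤ M + ∑' k : ℕ, ENNReal.ofReal ((Fintype.card ι : ℝ) ^ 2 * (K * ρ ^ (M + k))) := by
        gcongr with k
        refine (Finset.sum_le_card_nsmul _ _ _ (hterm k)).trans ?_
        rw [nsmul_eq_mul, ENNReal.ofReal_mul (p := (Fintype.card ι : ℝ) ^ 2) (by positivity),
          ENNReal.ofReal_pow (by positivity), ENNReal.ofReal_natCast]
        gcongr
        rw [Finset.offDiag_card, Finset.card_univ, sq]
        exact_mod_cast Nat.sub_le _ _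
    _ = _ := by
        rw [← ENNReal.ofReal_tsum_of_nonneg (fun k => by positivity) hsum.summable, hsum.tsum_eq,
          ENNReal.ofReal_add (by positivity)
            (mul_nonneg (by positivity) (div_nonneg hK (by linarith))), ENNReal.ofReal_natCast]

theorem exists_smoothedTrieHeight_le_log {α : Type} [Finite α] (S : Set (ℕ → α))
    (X : Perturbation α) {ρ K : ℝ} (hρ0 : 0 < ρ) (hρ1 : ρ < 1) (hK : 0 ≤ K)
    (h : ∀ t w, (X t : Measure (Str α)) (cylinder w) ≤ ENNReal.ofReal (K * ρ ^ w.length)) :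
    ∃ C : ℝ, ∀ᶠ n : ℕ in atTop,
      smoothedTrieHeight S n X ≤ ENNReal.ofReal (C * Real.log n) := by
  have hL : 0 < -Real.log ρ := neg_pos.2 (Real.log_neg hρ0 hρ1)
  refine ⟨2 / (-Real.log ρ) + (1 + K / (1 - ρ)), ?_⟩
  -- From `n ≥ 3 > e` one gets `log n ≥ 1`, which absorbs the additive constants into `C`.
  filter_upwards [eventually_ge_atTop 3] with n hn
  have hn3 : (3 : ℝ) ≤ n := by exact_mod_cast hn
  have hn0 : (0 : ℝ) < n := by linarith
  have hlog : 1 ≤ Real.log n := by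
    rw [Real.le_log_iff_exp_le hn0]
    exact (Real.exp_one_lt_d9.le.trans (by norm_num)).trans hn3
  -- The least natural number with `n ^ 2 * ρ ^ M ≤ 1`, so that the decay cancels the number of
  -- pairs.
  set M := ⌈2 * Real.log n / (-Real.log ρ)⌉₊ with hM
  have hM1 : (M : ℝ) ≤ 2 * Real.log n / (-Real.log ρ) + 1 :=
    (Nat.ceil_lt_add_one (by positivity)).le
  have hM2 : (n : ℝ) ^ 2 * ρ ^ M ≤ 1 := by
    have h1 : 2 * Real.log n ≤ M * (-Real.log ρ) := (div_le_iff₀ hL).1 (Nat.le_ceil _)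
    rw [← Real.log_nonpos_iff (by positivity), Real.log_mul (by positivity) (by positivity),
      Real.log_pow, Real.log_pow]
    push_cast
    linarith
  have hK' : 0 ≤ K / (1 - ρ) := div_nonneg hK (by linarith)
  refine iSup₂_le fun A hA => (lintegral_trieHeight_le
    (fun s : A => (X s.1 : Measure (Str α))) hρ0 hρ1 hK (fun i => h i.1) M).trans
    (ENNReal.ofReal_le_ofReal ?_)
  rw [Fintype.card_coe, hA.2]
  calc (M : ℝ) + (n : ℝ) ^ 2 * ρ ^ M * (K / (1 - ρ))
      ≤ (2 * Real.log n / (-Real.log ρ) + 1) + 1 * (K / (1 - ρ)) := by gcongr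
    _ ≤ 2 * Real.log n / (-Real.log ρ) + (1 + K / (1 - ρ)) * Real.log n := by
        nlinarith
    _ = _ := by ring

/-! ### Pure deletions: infinite height. -/

theorem sum_editState_ennreal (f : Unit ⊕ EditState → ℝ≥0∞) :
    ∑ p, f p = f (Sum.inl ()) + (f (Sum.inr (.sub true)) + f (Sum.inr (.sub false)) +
      (f (Sum.inr (.ins true)) + f (Sum.inr (.ins false))) +
      (f (Sum.inr (.del true)) + f (Sum.inr (.del false)))) := by
  have hu : (Finset.univ : Finset EditState) =
      {.sub true, .sub false, .ins true, .ins false, .del true, .del false} := by decide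
  rw [Fintype.sum_sum_type, hu]
  simp
  ring

/-- The configurations that a deletion perturbation can reach in `n` steps while reading zeros. -/
def IsZeroRun (n : ℕ) (c : Config Bool Unit EditState) : Prop :=
  c.pos ≤ n ∧ (∃ l, c.out = List.replicate l false) ∧
    (c.state = Sum.inl () ∨ c.state = Sum.inr (EditState.del false))

open Classical in
/-- A potential that decreases with the length of the output, and is infinite off the
configurations that a deletion perturbation can reach. -/
def deletionPotential (n : ℕ) (c : Config Bool Unit EditState) : ℝ≥0∞ :=
  if IsZeroRun n c then
    ENNReal.ofReal ((if c.state = Sum.inl () then 1 else 1 / 2) * (1 / 4) ^ c.out.length)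
  else ⊤

variable (pS pI qI pD vS vI vD : ℝ)
    (hpS : pS ∈ Set.Ioo (0 : ℝ) 1) (hpI : pI ∈ Set.Ioo (0 : ℝ) 1)
    (hqI : qI ∈ Set.Ioo (0 : ℝ) 1) (hpD : pD ∈ Set.Ioo (0 : ℝ) 1)
    (hvS : vS ∈ Set.Icc (0 : ℝ) 1) (hvI : vI ∈ Set.Icc (0 : ℝ) 1)
    (hvD : vD ∈ Set.Icc (0 : ℝ) 1) (hv : vS + vI + vD = 1)

/-- Reading gives exactly the factor `pD + (1 - pD) / 2 = (1 + pD) / 2`. Writing turns `1 / 2 * (1 /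
4) ^ l` into `(1 / 4) ^ (l + 1)`, a factor `1 / 2`, which is smaller. The bound `pos ≤ n < N`
ensures that the symbol read is a zero. -/
theorem lintegral_deletionPotential_le (hD : vD = 1) (t : ℕ → Bool) (N n : ℕ) (hn : n < N)
    (ht : ∀ k < N, t k = false) (c : Config Bool Unit EditState) :
    ∫⁻ d, deletionPotential (n + 1) d
        ∂((editPFA pS pI qI pD vS vI vD hpS hpI hqI hpD hvS hvI hvD hv).stepPMF t c).toMeasure ≤
      ENNReal.ofReal ((1 + pD) / 2) * deletionPotential n c := by
  have hS : vS = 0 := by linarith [hvS.1, hvI.1]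
  have hI : vI = 0 := by linarith [hvS.1, hvI.1]
  have h0 := hpD.1
  have h1 := hpD.2
  by_cases hc : IsZeroRun n c
  swap
  · rw [deletionPotential.eq_def n c, if_neg hc, ENNReal.mul_top]
    · exact le_top
    · simpa using by linarith
  obtain ⟨q, k, o⟩ := c
  obtain ⟨hk, ⟨l, hl⟩, hq⟩ := hc
  simp only at hk hl hq
  subst hl
  rcases hq with rfl | rfl
  · rw [PFA.lintegral_stepPMF_inl, sum_editState_ennreal]
    have e1 : deletionPotential (n + 1) ⟨Sum.inl (), k + 1, List.replicate l false⟩ =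
        ENNReal.ofReal ((1 / 4) ^ l) := by
      simp [deletionPotential, IsZeroRun, hk]
    have e2 : deletionPotential (n + 1)
        ⟨Sum.inr (EditState.del false), k + 1, List.replicate l false⟩ =
        ENNReal.ofReal (1 / 2 * (1 / 4) ^ l) := by
      simp [deletionPotential, IsZeroRun, hk]
    have e3 : deletionPotential n ⟨Sum.inl (), k, List.replicate l false⟩ =
        ENNReal.ofReal ((1 / 4) ^ l) := by
      simp [deletionPotential, IsZeroRun, hk]
    have htk := ht k (by omega)
    simp only [editPFA, editRead, htk, hS, hI, hD, e1, e2, e3, if_true, if_false,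
      Bool.true_eq_false, ENNReal.ofReal_zero, zero_mul, add_zero, zero_add, one_mul]
    rw [← ENNReal.ofReal_mul h0.le, ← ENNReal.ofReal_mul (by linarith),
      ← ENNReal.ofReal_add (by positivity)
        (mul_nonneg (by linarith) (by positivity)), ← ENNReal.ofReal_mul (by linarith)]
    refine ENNReal.ofReal_le_ofReal (le_of_eq ?_)
    ring
  · rw [PFA.lintegral_stepPMF_inr, Fintype.sum_bool, sum_editState_ennreal, sum_editState_ennreal]
    have e1 : deletionPotential (n + 1) ⟨Sum.inl (), k, List.replicate l false ++ [false]⟩ =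
        ENNReal.ofReal ((1 / 4) ^ (l + 1)) := by
      have h2 : k ≤ n + 1 := by omega
      have h3 : ∃ l', List.replicate l false ++ [false] = List.replicate l' false :=
        ⟨l + 1, List.replicate_succ'.symm⟩
      simp [deletionPotential, IsZeroRun, h2, h3]
    have e2 : deletionPotential n
        ⟨Sum.inr (EditState.del false), k, List.replicate l false⟩ =
        ENNReal.ofReal (1 / 2 * (1 / 4) ^ l) := by
      simp [deletionPotential, IsZeroRun, hk]
    simp only [editPFA, editWrite, e1, e2, reduceCtorEq, if_true, if_false, and_true, and_false,
      Bool.true_eq_false, ENNReal.ofReal_zero, ENNReal.ofReal_one, zero_mul, add_zero,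
      zero_add, one_mul]
    rw [← ENNReal.ofReal_mul (by linarith)]
    refine ENNReal.ofReal_le_ofReal ?_
    have : (0 : ℝ) ≤ (1 / 4) ^ l := by positivity
    rw [pow_succ]
    nlinarith

/-- Deletions of a long run of zeros leave, with high probability, many zeros. -/
theorem exists_compl_cylinder_le (hD : vD = 1) (k : ℕ) :
    ∃ N, ∀ t : ℕ → Bool, (∀ i < N, t i = false) →
      ((editPFA pS pI qI pD vS vI vD hpS hpI hqI hpD hvS hvI hvD hv).perturbation t :
        Measure (Str Bool)) (cylinder (List.replicate k false))ᶜ ≤ ENNReal.ofReal (1 / 4) := by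
  have hr0 : 0 ≤ (1 + pD) / 2 := by linarith [hpD.1]
  have hr1 : (1 + pD) / 2 < 1 := by linarith [hpD.2]
  -- With fewer than `k` zeros written the potential is at least `δ = 1 / 2 * (1 / 4) ^ k`, while
  -- its mean at time `N` is at most `((1 + pD) / 2) ^ N`; Markov's inequality then needs this power
  -- below `δ / 4`.
  obtain ⟨N, hN⟩ := exists_pow_lt_of_lt_one
    (show (0 : ℝ) < 1 / 4 * (1 / 2 * (1 / 4) ^ k) by positivity) hr1
  refine ⟨N, fun t ht => ?_⟩
  set X := editPFA pS pI qI pD vS vI vD hpS hpI hqI hpD hvS hvI hvD hv with hX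
  set δ : ℝ := 1 / 2 * (1 / 4) ^ k with hδ
  have hδ0 : 0 < δ := by positivity
  have h1 := X.lintegral_runLaw_le t (ENNReal.ofReal ((1 + pD) / 2)) deletionPotential N
    fun n hn c => lintegral_deletionPotential_le pS pI qI pD vS vI vD hpS hpI hqI hpD hvS hvI hvD
      hv hD t N n hn ht c
  have h2 : ∑ p, ENNReal.ofReal (X.sigma p) * deletionPotential 0 ⟨p, 0, []⟩ = 1 := by
    have e1 : deletionPotential 0 ⟨Sum.inl (), 0, []⟩ = 1 := by
      simp [deletionPotential, IsZeroRun]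
    rw [sum_editState_ennreal]
    simp [hX, editPFA, e1]
  rw [h2, mul_one, ← ENNReal.ofReal_pow hr0] at h1
  have h3 : ((X.perturbation t : Measure (Str Bool)) (cylinder (List.replicate k false))ᶜ) ≤
      X.runLaw t {c | ENNReal.ofReal δ ≤ deletionPotential N (c N)} := by
    have h4 : (X.perturbation t : Measure (Str Bool)) (cylinder (List.replicate k false))ᶜ =
        X.runLaw t (runOutput ⁻¹' (cylinder (List.replicate k false))ᶜ) :=
      Measure.map_apply measurable_runOutput (measurableSet_cylinder _).compl
    rw [h4]
    refine measure_mono_ae ?_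
    filter_upwards [X.ae_out_prefix_succ t] with c hc hmem
    have hnot : ¬ List.replicate k false <+: (c N).out := fun h =>
      hmem ((runOutput_mem_cylinder_iff hc _).2 ⟨N, h⟩)
    change ENNReal.ofReal δ ≤ deletionPotential N (c N)
    rw [deletionPotential]
    split_ifs with hz hs
    · obtain ⟨-, ⟨l, hl⟩, -⟩ := hz
      have hlk : l ≤ k := by
        by_contra! hlt
        exact hnot (hl ▸ ⟨List.replicate (l - k) false, by
          rw [List.replicate_append_replicate]; congr 1; omega⟩)
      refine ENNReal.ofReal_le_ofReal ?_
      rw [hl, List.length_replicate]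
      refine mul_le_mul (by norm_num) ?_ (by positivity) (by norm_num)
      exact pow_le_pow_of_le_one (by norm_num) (by norm_num) hlk
    · obtain ⟨-, ⟨l, hl⟩, -⟩ := hz
      have hlk : l ≤ k := by
        by_contra! hlt
        exact hnot (hl ▸ ⟨List.replicate (l - k) false, by
          rw [List.replicate_append_replicate]; congr 1; omega⟩)
      refine ENNReal.ofReal_le_ofReal ?_
      rw [hl, List.length_replicate]
      exact mul_le_mul_of_nonneg_left
        (pow_le_pow_of_le_one (by norm_num) (by norm_num) hlk) (by norm_num)
    -- Runs off the reachable configurations are simply counted as bad: the infinite value makes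
    -- Markov's inequality cover them.
    · exact le_top
  refine h3.trans ((meas_ge_le_lintegral_div ?_ ?_ ENNReal.ofReal_ne_top).trans ?_)
  · exact ((Measurable.of_discrete (f := deletionPotential N)).comp
      (measurable_pi_apply N)).aemeasurable
  · simpa using hδ0
  · rw [ENNReal.div_le_iff (by simpa using hδ0) ENNReal.ofReal_ne_top,
      ← ENNReal.ofReal_mul (by norm_num)]
    exact h1.trans (ENNReal.ofReal_le_ofReal hN.le)

theorem le_trieHeight_of_mem_cylinder {ι : Type} {x : ι → Str Bool} {i j : ι} (hij : i ≠ j)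
    {w : List Bool} (hi : x i ∈ cylinder w) (hj : x j ∈ cylinder w) :
    (w.length : ℕ∞) ≤ trieHeight x := by
  refine le_iSup_of_le i (le_iSup_of_le j (le_iSup_of_le hij ?_))
  refine le_iSup_of_le w.length (le_iSup_of_le (fun k hk => ?_) le_rfl)
  have := hi k hk
  have := hj k hk
  exact ⟨w[k], by simp_all, by simp_all⟩

theorem smoothedTrieHeight_eq_top (hD : vD = 1) {n : ℕ} (hn : 2 ≤ n) :
    smoothedTrieHeight (Set.univ : Set (ℕ → Bool)) n
      (editPFA pS pI qI pD vS vI vD hpS hpI hqI hpD hvS hvI hvD hv).perturbation = ⊤ := by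
  set X := editPFA pS pI qI pD vS vI vD hpS hpI hqI hpD hvS hvI hvD hv with hX
  refine ENNReal.eq_top_of_forall_nnreal_le fun r => ?_
  obtain ⟨k, hk⟩ := exists_nat_ge (2 * r)
  obtain ⟨N, hN⟩ := exists_compl_cylinder_le pS pI qI pD vS vI vD hpS hpI hqI hpD hvS hvI hvD hv
    hD k
  -- A single one at position `N + i` keeps the strings distinct and leaves their first `N` symbols
  -- zero.
  let f : ℕ → ℕ → Bool := fun i j => decide (j = N + i)
  have hf : Function.Injective f := fun i i' h => by
    have := congrFun h (N + i)
    simpa [f] using this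
  have hzero : ∀ i, ∀ j < N, f i j = false := fun i j hj => by
    simp only [f, decide_eq_false_iff_not]; omega
  let A : Finset (ℕ → Bool) := (Finset.range n).map ⟨f, hf⟩
  have hA : ∀ i < n, f i ∈ A := fun i hi =>
    Finset.mem_map.2 ⟨i, Finset.mem_range.2 hi, rfl⟩
  refine le_iSup₂_of_le A ⟨Set.subset_univ _, by simp [A]⟩ ?_
  let a : A := ⟨f 0, hA 0 (by omega)⟩
  let b : A := ⟨f 1, hA 1 (by omega)⟩
  have hab : a ≠ b := fun h => zero_ne_one (hf (congrArg Subtype.val h))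
  set μ := Measure.pi fun s : A => (X.perturbation s.1 : Measure (Str Bool)) with hμ
  let Z := cylinder (List.replicate k false)
  let E : Set (A → Str Bool) := (fun x => x a) ⁻¹' Z ∩ (fun x => x b) ⁻¹' Z
  have hE : MeasurableSet E := (measurable_pi_apply a (measurableSet_cylinder _)).inter
    (measurable_pi_apply b (measurableSet_cylinder _))
  have hc : ∀ s : A, (∀ j < N, s.1 j = false) →
      μ ((fun x => x s) ⁻¹' Zᶜ) ≤ ENNReal.ofReal (1 / 4) := fun s hs => by
    rw [(measurePreserving_eval (fun s : A => (X.perturbation s.1 : Measure (Str Bool)))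
      s).measure_preimage (measurableSet_cylinder _).compl.nullMeasurableSet]
    exact hN s.1 hs
  have hEc : μ Eᶜ ≤ ENNReal.ofReal (1 / 2) := by
    rw [Set.compl_inter]
    refine (measure_union_le _ _).trans ((add_le_add (hc a (hzero 0)) (hc b (hzero 1))).trans ?_)
    rw [← ENNReal.ofReal_add (by norm_num) (by norm_num)]
    norm_num
  have hE2 : ENNReal.ofReal (1 / 2) ≤ μ E := by
    have h1 := prob_compl_eq_one_sub (μ := μ) hE.compl
    rw [compl_compl] at h1
    rw [h1]
    refine le_trans (le_of_eq ?_) (tsub_le_tsub_left hEc 1)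
    rw [← ENNReal.ofReal_one, ← ENNReal.ofReal_sub _ (by norm_num)]
    norm_num
  calc (r : ℝ≥0∞) ≤ (k : ℝ≥0∞) * ENNReal.ofReal (1 / 2) := by
        rw [← ENNReal.ofReal_natCast, ← ENNReal.ofReal_mul (by positivity),
          ← ENNReal.ofReal_coe_nnreal]
        refine ENNReal.ofReal_le_ofReal ?_
        have : (2 * r : ℝ) ≤ k := by exact_mod_cast hk
        linarith
    _ ≤ k * μ E := by gcongr
    _ = ∫⁻ x, E.indicator (fun _ => (k : ℝ≥0∞)) x ∂μ := by
        rw [lintegral_indicator_const hE]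
    _ ≤ ∫⁻ x, (trieHeight x : ℝ≥0∞) ∂μ := by
        refine lintegral_mono fun x => ?_
        refine Set.indicator_le' (s := E) (f := fun _ => (k : ℝ≥0∞))
          (g := fun x => (trieHeight x : ℝ≥0∞)) (fun x hx => ?_) (fun _ _ => zero_le) x
        have := le_trieHeight_of_mem_cylinder hab hx.1 hx.2
        rw [List.length_replicate] at this
        exact_mod_cast ENat.toENNReal_le.2 this

end SmoothedTrie

end

theorem mainTheorem2 (pS pI qI pD vS vI vD : ℝ)
    (hpS : pS ∈ Set.Ioo (0 : ℝ) 1) (hpI : pI ∈ Set.Ioo (0 : ℝ) 1)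
    (hqI : qI ∈ Set.Ioo (0 : ℝ) 1) (hpD : pD ∈ Set.Ioo (0 : ℝ) 1)
    (hvS : vS ∈ Set.Icc (0 : ℝ) 1) (hvI : vI ∈ Set.Icc (0 : ℝ) 1)
    (hvD : vD ∈ Set.Icc (0 : ℝ) 1) (hv : vS + vI + vD = 1) :
    (∃ C : ℝ, ∀ᶠ n : ℕ in atTop,
      SmoothedTrie.smoothedTrieHeight (Set.univ : Set (ℕ → Bool)) n
          (SmoothedTrie.editPFA pS pI qI pD vS vI vD hpS hpI hqI hpD hvS hvI hvD hv).perturbation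
        ≤ ENNReal.ofReal (C * Real.log n)) ↔ vD < 1 := by
  constructor
  · rintro ⟨C, hC⟩
    refine lt_of_le_of_ne hvD.2 fun hD => ?_
    obtain ⟨n, h1, h2⟩ := (hC.and (eventually_ge_atTop 2)).exists
    rw [SmoothedTrie.smoothedTrieHeight_eq_top pS pI qI pD vS vI vD hpS hpI hqI hpD hvS hvI hvD hv
      hD h2] at h1
    exact ENNReal.ofReal_ne_top (top_le_iff.1 h1)
  · intro hD
    obtain ⟨ρ, K, hρ0, hρ1, hK, h⟩ := SmoothedTrie.exists_perturbation_cylinder_le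
      pS pI qI pD vS vI vD hpS hpI hqI hpD hvS hvI hvD hv hD
    exact SmoothedTrie.exists_smoothedTrieHeight_le_log _ _ hρ0 hρ1 hK h
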